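/- Let $L$ be a positive definite even lattice, i.e. a free abelian group of finite rank with a symmetric positive definite $\mathbb Z$-valued bilinear form $\langle\cdot,\cdot\rangle$ such that $\langle x,x\rangle$ is even for all $x\in L$. Let $L^\circ=\{\beta\in\mathbb Q\otimes L : \langle\alpha,\beta\rangle\in\mathbb Z \text{ for all } \alpha\in L\}$. A screener of $L$ is an element $\beta\in L$ of even norm $\langle\beta,\beta\rangle$ with $\beta\notin 2L$ and $2\beta/\langle\beta,\beta\rangle\in L^\circ$; a screening system is a linearly independent set of screeners. **Theorem 5.11.** Suppose that $L$ is generated, as an abelian group, by a screening system. Then there are $m\ge 0$, positive integers $p_1,\dots,p_m$, lattices $K_1,\dots,K_m$, each of which is one of the simply laced root lattices $A_n$ ($n\ge 1$), $D_n$ ($n\ge 4$), $E_6$, $E_7$, $E_8$, and a $\mathbb Z$-basis $\mathcal B=\mathcal B_1\sqcup\dots\sqcup\mathcal B_m$ of $L$ consisting of screeners, such that $L$ is the orthogonal direct sum of the sublattices $L_i=\mathbb Z\mathcal B_i$ and, for every $i$, $L_i$ is isometric to $\sqrt{p_i}\,K_i$ by an isometry that carries the simple roots of $K_i$ onto $\mathcal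 B_i$. Here $K_i$ is the lattice with $\mathbb Z$-basis the simple roots and Gram matrix the Cartan matrix of its type, and $\sqrt{p}\,K$ is the group $K$ with its form multiplied by $p$. -/

import Mathlib

open scoped TensorProduct

noncomputable section

namespace ScreeningLattice

section Screeners

variable {L : Type*} [AddCommGroup L]

/-- A positive definite even integral lattice structure: a symmetric positive definite `ℤ`-valued
bilinear form all of whose norms `⟨x, x⟩` are even. (That the underlying group is free of finite
rank is asked for separately.) -/
structure IsPosDefEven (B : LinearMap.BilinForm ℤ L) : Prop where
  symm : ∀ x y, B x y = B y x
  pos : ∀ x, x ≠ 0 → 0 < B x x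
  even : ∀ x, Even (B x x)

/-- The rational dual `L° = {β ∈ ℚ ⊗ L | ⟨α, β⟩ ∈ ℤ for all α ∈ L}`. -/
def dualLattice (B : LinearMap.BilinForm ℤ L) : Set (ℚ ⊗[ℤ] L) :=
  {β | ∀ α : L, ∃ n : ℤ, B.baseChange ℚ ((1 : ℚ) ⊗ₜ[ℤ] α) β = (n : ℚ)}

/-- The set `Φ` of screeners: the elements `β` of even norm with `β ∉ 2L` and
`2β / ⟨β, β⟩ ∈ L°`. The element `β = 0` is excluded by `β ∉ 2L`. -/
def screeners (B : LinearMap.BilinForm ℤ L) : Set L :=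
  {β | Even (B β β) ∧ (¬ ∃ γ : L, β = (2 : ℤ) • γ) ∧
    (2 / ((B β β : ℤ) : ℚ)) ⊗ₜ[ℤ] β ∈ dualLattice B}

/-- A screening system: a linearly independent set of screeners. (Since `L` is free, independence
over `ℤ` in `L` is the same as independence over `ℂ` in `ℂ ⊗ L`.) -/
def IsScreeningSystem (B : LinearMap.BilinForm ℤ L) (S : Set L) : Prop :=
  S ⊆ screeners B ∧ LinearIndependent ℤ (fun x : S => (x : L))

/-- `L` is the internal orthogonal direct sum of the sublattices `N i`. -/
def IsOrthogonalDirectSum (B : LinearMap.BilinForm ℤ L) {m : ℕ}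
    (N : Fin m → Submodule ℤ L) : Prop :=
  DirectSum.IsInternal N ∧ ∀ i j, i ≠ j → ∀ x ∈ N i, ∀ y ∈ N j, B x y = 0

end Screeners

/-- The simply laced types `A_n` (`n ≥ 1`), `D_n` (`n ≥ 4`), `E₆`, `E₇`, `E₈`. -/
inductive SimplyLacedType : Type
  | A (n : ℕ) (hn : 1 ≤ n)
  | D (n : ℕ) (hn : 4 ≤ n)
  | E₆
  | E₇
  | E₈

namespace SimplyLacedType

/-- The rank of a simply laced type. -/
def rank : SimplyLacedType → ℕ
  | A n _ => n
  | D n _ => n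
  | E₆ => 6
  | E₇ => 7
  | E₈ => 8

/-- The Cartan matrix of a simply laced type. -/
def cartanMatrix : (X : SimplyLacedType) → Matrix (Fin X.rank) (Fin X.rank) ℤ
  | A n _ => CartanMatrix.A n
  | D n _ => CartanMatrix.D n
  | E₆ => CartanMatrix.E₆
  | E₇ => CartanMatrix.E₇
  | E₈ => CartanMatrix.E₈

/-- The root lattice of type `X`: the free group `ℤ ^ rank` on the simple roots, with the bilinear
form whose Gram matrix in the simple roots is the Cartan matrix. -/
def rootForm (X : SimplyLacedType) : LinearMap.BilinForm ℤ (Fin X.rank → ℤ) :=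
  Matrix.toBilin' X.cartanMatrix

/-- The `j`-th simple root of the root lattice of type `X`. -/
def simpleRoot (X : SimplyLacedType) (j : Fin X.rank) : Fin X.rank → ℤ :=
  Pi.single j 1

/-- The bilinear form of the rescaled root lattice `√p K`, with `K` the root lattice of type `X`:
it is `p` times the form of `K`. -/
def rescaledForm (p : ℕ) (X : SimplyLacedType) : LinearMap.BilinForm ℤ (Fin X.rank → ℤ) :=
  (p : ℤ) • X.rootForm

end SimplyLacedType

end ScreeningLattice

end

open ScreeningLattice

/-! A screener `x` has integral Cartan numbers `2⟨x, y⟩ / ⟨x, x⟩` with all `y` in `L`, so the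
reflection in `x` preserves `L` and permutes the screeners. Screeners may have several lengths, but
the short ones, no longer than any screener they are not orthogonal to, already generate `L`: if `y`
is a shorter screener at an acute angle to `x`, then `x = y - (y - x)`, where `y - x` is the mirror
image of `y` in `x` and has the length of `y` (`screeners_subset_span_shortScreeners`).

Non-orthogonal short screeners have equal norm and, unless equal or opposite, meet at `π/3` or
`2π/3`. There are finitely many, since congruence modulo `5L` separates them. A generic functional
therefore selects simple roots (`exists_isSimplyLacedSystem`); these are independent because their
angles are never acute, and they span `L`, so they are the required basis.

It remains to classify the diagram. By `isSimplyLacedFinite_extendMatrix`, an ADE diagram with one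
more vertex joined to it is again ADE. Hence an ADE subdiagram of maximal rank is orthogonal to all
other simple roots; it is split off and the argument repeated. In the extension step, positivity at
the highest root plus the new vertex leaves a single edge, ending at a vertex of coefficient `1`.
The surviving bad cases contain affine `E₇` or `E₈`. -/

namespace ScreeningLattice

/-! ### Copositive matrices and diagrams with one added vertex -/

section QuadraticForm

variable {ι κ : Type*} [Fintype ι] [Fintype κ]

/-- The quadratic form `∑ i j, c i * c j * M i j` of a square matrix. -/
def quadForm (M : Matrix ι ι ℤ) (c : ι → ℤ) : ℤ := ∑ i, ∑ j, c i * c j * M i j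

/-- A matrix is strictly copositive if its quadratic form is positive at every nonzero vector with
nonnegative entries. -/
def StrictlyCopositive (M : Matrix ι ι ℤ) : Prop :=
  ∀ c : ι → ℤ, (∀ i, 0 ≤ c i) → c ≠ 0 → 0 < quadForm M c

lemma quadForm_submatrix_extend (M : Matrix κ κ ℤ) {σ : ι → κ} (hσ : Function.Injective σ)
    (c : ι → ℤ) : quadForm M (Function.extend σ c 0) = quadForm (M.submatrix σ σ) c := by
  refine (Fintype.sum_of_injective σ hσ _ _ (fun i hi => ?_) fun i => ?_).symm
  · simp [Function.extend_apply' c (0 : κ → ℤ) i (by simpa using hi)]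
  · refine Fintype.sum_of_injective σ hσ _ _ (fun j hj => ?_) fun j => ?_
    · simp [Function.extend_apply' c (0 : κ → ℤ) j (by simpa using hj)]
    · simp [hσ.extend_apply]

lemma quadForm_submatrix_equiv (M : Matrix κ κ ℤ) (σ : ι ≃ κ) (c : κ → ℤ) :
    quadForm (M.submatrix σ σ) (c ∘ σ) = quadForm M c := by
  refine Fintype.sum_equiv σ _ _ fun i => Fintype.sum_equiv σ _ _ fun j => ?_
  simp

lemma StrictlyCopositive.submatrix {M : Matrix κ κ ℤ} (hM : StrictlyCopositive M) {σ : ι → κ}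
    (hσ : Function.Injective σ) : StrictlyCopositive (M.submatrix σ σ) := by
  intro c hc hc0
  rw [← quadForm_submatrix_extend M hσ]
  refine hM _ (fun i => ?_) fun h => hc0 ?_
  · by_cases hi : ∃ j, σ j = i
    · obtain ⟨j, rfl⟩ := hi
      simpa [hσ.extend_apply] using hc j
    · simp [Function.extend_apply' c (0 : κ → ℤ) i hi]
  · ext j
    simpa [hσ.extend_apply] using congrFun h (σ j)

end QuadraticForm

/-- The matrix obtained from `C` by adding a new row and column, with diagonal entry `2` and
off-diagonal entries `-a i`. -/
def extendMatrix {n : ℕ} (C : Matrix (Fin n) (Fin n) ℤ) (a : Fin n → ℤ) :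
    Matrix (Option (Fin n)) (Option (Fin n)) ℤ
  | none, none => 2
  | none, some j => -a j
  | some i, none => -a i
  | some i, some j => C i j

section ExtendMatrix

variable {n : ℕ} (C : Matrix (Fin n) (Fin n) ℤ) (a : Fin n → ℤ)

@[simp] lemma extendMatrix_none_none : extendMatrix C a none none = 2 := rfl
@[simp] lemma extendMatrix_none_some (j) : extendMatrix C a none (some j) = -a j := rfl
@[simp] lemma extendMatrix_some_none (i) : extendMatrix C a (some i) none = -a i := rfl
@[simp] lemma extendMatrix_some_some (i j) : extendMatrix C a (some i) (some j) = C i j := rfl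

lemma quadForm_extendMatrix (c : Option (Fin n) → ℤ) :
    quadForm (extendMatrix C a) c =
      2 * c none ^ 2 - 2 * c none * ∑ i, a i * c (some i) + quadForm C (c ∘ some) := by
  simp only [quadForm, Fintype.sum_option, extendMatrix_none_none, extendMatrix_none_some,
    extendMatrix_some_none, extendMatrix_some_some, Finset.sum_add_distrib, Finset.mul_sum,
    Function.comp_apply, mul_neg, Finset.sum_neg_distrib]
  have h1 : ∑ i, c none * c (some i) * a i = ∑ i, c none * (a i * c (some i)) :=
    Finset.sum_congr rfl fun i _ => by ring
  have h2 : ∑ i, c (some i) * c none * a i = ∑ i, c none * (a i * c (some i)) :=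
    Finset.sum_congr rfl fun i _ => by ring
  have h3 : ∑ i, 2 * c none * (a i * c (some i)) = 2 * ∑ i, c none * (a i * c (some i)) := by
    rw [Finset.mul_sum]; exact Finset.sum_congr rfl fun i _ => by ring
  rw [h1, h2, h3]
  ring

lemma extendMatrix_submatrix_optionCongr (τ : Fin n ≃ Fin n)
    (hτ : ∀ i j, C (τ i) (τ j) = C i j) (k : Fin n) :
    (extendMatrix C (Pi.single (τ k) 1)).submatrix τ.optionCongr τ.optionCongr =
      extendMatrix C (Pi.single k 1) := by
  ext (_ | i) (_ | j) <;> simp [hτ, Pi.single_apply]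

/-- If `h` is a root of `C` then the new vertex is joined to it at most once. -/
lemma StrictlyCopositive.sum_mul_le_one {C : Matrix (Fin n) (Fin n) ℤ} {a : Fin n → ℤ}
    (hpos : StrictlyCopositive (extendMatrix C a)) {h : Fin n → ℤ} (h0 : ∀ i, 0 ≤ h i)
    (hq : quadForm C h = 2) : ∑ i, a i * h i ≤ 1 := by
  -- At the new vertex plus `h` the form equals `2 - 2 ∑ a i * h i + 2`.
  have := hpos (fun i => i.elim 1 h) (by rintro (_ | i) <;> simp [h0])
    (fun h => by simpa using congrFun h none)
  rw [quadForm_extendMatrix] at this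
  have h' : ((fun i => i.elim 1 h) ∘ some : Fin n → ℤ) = h := rfl
  rw [h', hq] at this
  simp only [Option.elim] at this
  omega

/-- Every neighbour `i` of the new vertex contributes `h i ≥ 1` to the sum, so there is room for
only one, and its coefficient is `1`. -/
lemma eq_single_of_sum_mul_le_one {a h : Fin n → ℤ} (ha : ∀ i, a i = 0 ∨ a i = 1) (ha0 : a ≠ 0)
    (h1 : ∀ i, 1 ≤ h i) (hs : ∑ i, a i * h i ≤ 1) : ∃ k, h k = 1 ∧ a = Pi.single k 1 := by
  obtain ⟨k, hk⟩ := Function.ne_iff.1 ha0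
  have hk1 : a k = 1 := (ha k).resolve_left hk
  have hnn : ∀ i, 0 ≤ a i * h i := fun i =>
    mul_nonneg (by rcases ha i with h | h <;> simp [h]) (by linarith [h1 i])
  have hrest := Finset.add_sum_erase Finset.univ (fun i => a i * h i) (Finset.mem_univ k)
  have hrest0 : 0 ≤ ∑ i ∈ Finset.univ.erase k, a i * h i := Finset.sum_nonneg fun i _ => hnn i
  simp only [hk1, one_mul] at hrest
  refine ⟨k, by linarith [h1 k], ?_⟩
  have hz : ∑ i ∈ Finset.univ.erase k, a i * h i = 0 := by linarith [h1 k]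
  rw [Finset.sum_eq_zero_iff_of_nonneg fun i _ => hnn i] at hz
  ext i
  by_cases hi : i = k
  · subst hi; simp [hk1]
  · have := hz i (by simp [hi])
    rw [Pi.single_eq_of_ne hi]
    rcases mul_eq_zero.1 this with h | h
    · exact h
    · linarith [h1 i]

end ExtendMatrix

/-- A matrix is of simply laced finite type if it is, up to relabelling, the Cartan matrix of one of
the types `A_n`, `D_n`, `E₆`, `E₇`, `E₈`. -/
def IsSimplyLacedFinite {ι : Type*} (M : Matrix ι ι ℤ) : Prop :=
  ∃ (X : SimplyLacedType) (σ : Fin X.rank ≃ ι), X.cartanMatrix = M.submatrix σ σ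

lemma IsSimplyLacedFinite.of_submatrix {ι κ : Type*} {M : Matrix κ κ ℤ} (σ : ι ≃ κ)
    (h : IsSimplyLacedFinite (M.submatrix σ σ)) : IsSimplyLacedFinite M := by
  obtain ⟨X, τ, hX⟩ := h
  exact ⟨X, τ.trans σ, hX⟩

/-! ### Highest roots of `A_n` and `D_n` -/

section HighestRoot

lemma cartanMatrix_A_add_two (m : ℕ) :
    CartanMatrix.A (m + 2) =
      (extendMatrix (CartanMatrix.A (m + 1)) (Pi.single 0 1)).submatrix
        (finSuccEquiv (m + 1)) (finSuccEquiv (m + 1)) := by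
  ext i j
  refine Fin.cases ?_ (fun i => ?_) i <;> refine Fin.cases ?_ (fun j => ?_) j <;>
    simp only [CartanMatrix.A, Pi.single_apply, Fin.ext_iff, Matrix.of_apply,
      Matrix.submatrix_apply, finSuccEquiv_zero, finSuccEquiv_succ, extendMatrix_none_none,
      extendMatrix_none_some, extendMatrix_some_none, extendMatrix_some_some, Fin.val_zero,
      Fin.val_succ] <;> grind

lemma cartanMatrix_D_succ {n : ℕ} (hn : 3 ≤ n) :
    CartanMatrix.D (n + 1) =
      (extendMatrix (CartanMatrix.D n) (Pi.single ⟨0, by omega⟩ 1)).submatrix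
        (finSuccEquiv n) (finSuccEquiv n) := by
  ext i j
  refine Fin.cases ?_ (fun i => ?_) i <;> refine Fin.cases ?_ (fun j => ?_) j <;>
    simp [CartanMatrix.D, Pi.single_apply, Fin.ext_iff] <;> grind

lemma quadForm_A_one (m : ℕ) : quadForm (CartanMatrix.A (m + 1)) 1 = 2 := by
  induction m with
  | zero => decide
  | succ m ih =>
    rw [cartanMatrix_A_add_two, show (1 : Fin (m + 2) → ℤ) =
      (1 : Option (Fin (m + 1)) → ℤ) ∘ finSuccEquiv (m + 1) from rfl,
      quadForm_submatrix_equiv, quadForm_extendMatrix, show (1 : Option (Fin (m + 1)) → ℤ) ∘ some =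
      1 from rfl, ih]
    simp

/-- In the usual coordinates this vector is `2ε₁`. It is the part of the highest root of `D_{n+1}`
supported on the subdiagram `D_n`. -/
lemma quadForm_D_two {n : ℕ} (hn : 3 ≤ n) :
    quadForm (CartanMatrix.D n) (fun i => if i.val + 2 < n then 2 else 1) = 4 := by
  induction n, hn using Nat.le_induction with
  | base => decide
  | succ n hn ih =>
    rw [cartanMatrix_D_succ hn, ← quadForm_submatrix_equiv _ (finSuccEquiv n).symm]
    simp only [Matrix.submatrix_submatrix, Equiv.self_comp_symm, Matrix.submatrix_id_id]
    rw [quadForm_extendMatrix]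
    have : (((fun i : Fin (n + 1) => if i.val + 2 < n + 1 then 2 else 1) ∘
      (finSuccEquiv n).symm) ∘ some : Fin n → ℤ) = fun i => if i.val + 2 < n then 2 else 1 := by
      ext i; simp; grind
    rw [this, ih]
    simp only [Pi.single_apply, ite_mul, one_mul, zero_mul, Finset.sum_ite_eq', Finset.mem_univ,
      Function.comp_apply, finSuccEquiv_symm_none, finSuccEquiv_symm_some, Fin.val_zero,
      Fin.val_succ]
    grind

/-- The coefficients of the highest root of `D_n`. -/
lemma quadForm_D_highestRoot {n : ℕ} (hn : 4 ≤ n) :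
    quadForm (CartanMatrix.D n)
      (fun i => if i.val ≠ 0 ∧ i.val + 2 < n then 2 else 1) = 2 := by
  obtain ⟨n, rfl⟩ : ∃ m, n = m + 1 := ⟨n - 1, by omega⟩
  rw [cartanMatrix_D_succ (by omega), ← quadForm_submatrix_equiv _ (finSuccEquiv n).symm]
  simp only [Matrix.submatrix_submatrix, Equiv.self_comp_symm, Matrix.submatrix_id_id]
  rw [quadForm_extendMatrix]
  have : (((fun i : Fin (n + 1) => if i.val ≠ 0 ∧ i.val + 2 < n + 1 then 2 else 1) ∘
    (finSuccEquiv n).symm) ∘ some : Fin n → ℤ) = fun i => if i.val + 2 < n then 2 else 1 := by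
    ext i; simp; grind
  rw [this, quadForm_D_two (by omega)]
  simp only [Pi.single_apply, ite_mul, one_mul, zero_mul, Finset.sum_ite_eq', Finset.mem_univ,
    Function.comp_apply, finSuccEquiv_symm_none, finSuccEquiv_symm_some, Fin.val_zero,
    Fin.val_succ]
  grind

end HighestRoot

/-! ### Extending an ADE diagram by one vertex -/

section Extension

lemma isSimplyLacedFinite_A {n : ℕ} (hn : 1 ≤ n) : IsSimplyLacedFinite (CartanMatrix.A n) :=
  ⟨.A n hn, Equiv.refl _, rfl⟩

lemma isSimplyLacedFinite_D {n : ℕ} (hn : 4 ≤ n) : IsSimplyLacedFinite (CartanMatrix.D n) :=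
  ⟨.D n hn, Equiv.refl _, rfl⟩

lemma isSimplyLacedFinite_E₆ : IsSimplyLacedFinite CartanMatrix.E₆ := ⟨.E₆, Equiv.refl _, rfl⟩

lemma isSimplyLacedFinite_E₇ : IsSimplyLacedFinite CartanMatrix.E₇ := ⟨.E₇, Equiv.refl _, rfl⟩

lemma isSimplyLacedFinite_E₈ : IsSimplyLacedFinite CartanMatrix.E₈ := ⟨.E₈, Equiv.refl _, rfl⟩

lemma IsSimplyLacedFinite.of_equiv {ι κ : Type*} {C : Matrix ι ι ℤ} {M : Matrix κ κ ℤ}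
    (hC : IsSimplyLacedFinite C) (σ : ι ≃ κ) (h : C = M.submatrix σ σ) :
    IsSimplyLacedFinite M :=
  .of_submatrix σ (h ▸ hC)

lemma IsSimplyLacedFinite.of_bijective {ι κ : Type*} {C : Matrix ι ι ℤ} {M : Matrix κ κ ℤ}
    (hC : IsSimplyLacedFinite C) (σ : ι → κ) (hσ : Function.Bijective σ)
    (h : C = M.submatrix σ σ) : IsSimplyLacedFinite M :=
  hC.of_equiv (Equiv.ofBijective σ hσ) h

lemma isSimplyLacedFinite_extendMatrix_A_last {n : ℕ} (k : Fin n) (hk : k.val + 1 = n) :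
    IsSimplyLacedFinite (extendMatrix (CartanMatrix.A n) (Pi.single k 1)) := by
  refine (isSimplyLacedFinite_A (n := n + 1) (by omega)).of_equiv finSuccEquivLast ?_
  ext i j
  refine Fin.lastCases ?_ (fun i => ?_) i <;> refine Fin.lastCases ?_ (fun j => ?_) j <;>
    simp only [CartanMatrix.A, Pi.single_apply, Fin.ext_iff, Matrix.of_apply,
      Matrix.submatrix_apply, finSuccEquivLast_castSucc, finSuccEquivLast_last,
      extendMatrix_none_none, extendMatrix_none_some, extendMatrix_some_none,
      extendMatrix_some_some, Fin.val_last, Fin.val_castSucc] <;> grind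

lemma isSimplyLacedFinite_extendMatrix_A_penultimate {n : ℕ} (hn : 3 ≤ n) (k : Fin n)
    (hk : k.val + 2 = n) :
    IsSimplyLacedFinite (extendMatrix (CartanMatrix.A n) (Pi.single k 1)) := by
  refine (isSimplyLacedFinite_D (n := n + 1) (by omega)).of_equiv finSuccEquivLast ?_
  ext i j
  refine Fin.lastCases ?_ (fun i => ?_) i <;> refine Fin.lastCases ?_ (fun j => ?_) j <;>
    simp only [CartanMatrix.A, CartanMatrix.D, Pi.single_apply, Fin.ext_iff, Matrix.of_apply,
      Matrix.submatrix_apply, finSuccEquivLast_castSucc, finSuccEquivLast_last,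
      extendMatrix_none_none, extendMatrix_none_some, extendMatrix_some_none,
      extendMatrix_some_some, Fin.val_last, Fin.val_castSucc] <;> grind

/-- The list gives the image of each vertex of `E₆`. Vertex `1` is the short leg, attached to vertex
`3`, so it goes to the new vertex. The lists below are read in the same way. -/
lemma isSimplyLacedFinite_extendMatrix_A_five :
    IsSimplyLacedFinite (extendMatrix (CartanMatrix.A 5) (Pi.single 2 1)) :=
  isSimplyLacedFinite_E₆.of_bijective ![some 0, none, some 1, some 2, some 3, some 4]
    (by decide) (by decide)

lemma isSimplyLacedFinite_extendMatrix_A_six :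
    IsSimplyLacedFinite (extendMatrix (CartanMatrix.A 6) (Pi.single 3 1)) :=
  isSimplyLacedFinite_E₇.of_bijective ![some 5, none, some 4, some 3, some 2, some 1, some 0]
    (by decide) (by decide)

lemma isSimplyLacedFinite_extendMatrix_A_seven :
    IsSimplyLacedFinite (extendMatrix (CartanMatrix.A 7) (Pi.single 4 1)) :=
  isSimplyLacedFinite_E₈.of_bijective
    ![some 6, none, some 5, some 4, some 3, some 2, some 1, some 0]
    (by decide) (by decide)

lemma isSimplyLacedFinite_extendMatrix_D_four :
    IsSimplyLacedFinite (extendMatrix (CartanMatrix.D 4) (Pi.single 3 1)) :=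
  (isSimplyLacedFinite_D (by norm_num)).of_bijective ![none, some 3, some 1, some 0, some 2]
    (by decide) (by decide)

lemma isSimplyLacedFinite_extendMatrix_D_five :
    IsSimplyLacedFinite (extendMatrix (CartanMatrix.D 5) (Pi.single 4 1)) :=
  isSimplyLacedFinite_E₆.of_bijective ![none, some 3, some 4, some 2, some 1, some 0]
    (by decide) (by decide)

lemma isSimplyLacedFinite_extendMatrix_D_six :
    IsSimplyLacedFinite (extendMatrix (CartanMatrix.D 6) (Pi.single 5 1)) :=
  isSimplyLacedFinite_E₇.of_bijective ![none, some 4, some 5, some 3, some 2, some 1, some 0]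
    (by decide) (by decide)

lemma isSimplyLacedFinite_extendMatrix_D_seven :
    IsSimplyLacedFinite (extendMatrix (CartanMatrix.D 7) (Pi.single 6 1)) :=
  isSimplyLacedFinite_E₈.of_bijective
    ![none, some 5, some 6, some 4, some 3, some 2, some 1, some 0]
    (by decide) (by decide)

lemma isSimplyLacedFinite_extendMatrix_E₆ :
    IsSimplyLacedFinite (extendMatrix CartanMatrix.E₆ (Pi.single 5 1)) :=
  isSimplyLacedFinite_E₇.of_bijective ![some 0, some 1, some 2, some 3, some 4, some 5, none]
    (by decide) (by decide)

lemma isSimplyLacedFinite_extendMatrix_E₇ :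
    IsSimplyLacedFinite (extendMatrix CartanMatrix.E₇ (Pi.single 6 1)) :=
  isSimplyLacedFinite_E₈.of_bijective
    ![some 0, some 1, some 2, some 3, some 4, some 5, some 6, none]
    (by decide) (by decide)

/-- The affine diagram of type `E₇` is not strictly copositive. -/
lemma not_strictlyCopositive_extendMatrix_A_seven :
    ¬ StrictlyCopositive (extendMatrix (CartanMatrix.A 7) (Pi.single 3 1)) := fun h =>
  -- The marks of the affine diagram form a null vector of its quadratic form; the first number is
  -- the mark of the new vertex.
  absurd (h (fun i => i.elim 2 ![1, 2, 3, 4, 3, 2, 1]) (by decide) (by decide)) (by decide)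

/-- The affine diagram of type `E₈` is not strictly copositive. -/
lemma not_strictlyCopositive_extendMatrix_A_eight :
    ¬ StrictlyCopositive (extendMatrix (CartanMatrix.A 8) (Pi.single 5 1)) := fun h =>
  absurd (h (fun i => i.elim 3 ![1, 2, 3, 4, 5, 6, 4, 2]) (by decide) (by decide)) (by decide)

/-- The affine diagram of type `E₈` is not strictly copositive. -/
lemma not_strictlyCopositive_extendMatrix_D_eight :
    ¬ StrictlyCopositive (extendMatrix (CartanMatrix.D 8) (Pi.single 7 1)) := fun h =>
  absurd (h (fun i => i.elim 2 ![1, 2, 3, 4, 5, 6, 3, 4]) (by decide) (by decide)) (by decide)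

/-- Used to locate an affine diagram of fixed size inside an arbitrarily long one. For `D_n`, the
window must reach the forked end. -/
lemma extendMatrix_A_submatrix_shift {m n : ℕ} (s : ℕ) (hs : s + m ≤ n) (k : Fin m) :
    (extendMatrix (CartanMatrix.A n) (Pi.single ⟨s + k, by omega⟩ 1)).submatrix
      (Option.map fun i : Fin m => ⟨s + i, by omega⟩)
      (Option.map fun i : Fin m => ⟨s + i, by omega⟩) =
      extendMatrix (CartanMatrix.A m) (Pi.single k 1) := by
  ext (_ | i) (_ | j) <;> simp only [CartanMatrix.A, Pi.single_apply, Fin.ext_iff,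
    Matrix.of_apply, Matrix.submatrix_apply, Option.map_none, Option.map_some,
    extendMatrix_none_none, extendMatrix_none_some, extendMatrix_some_none,
    extendMatrix_some_some] <;> grind

lemma extendMatrix_D_submatrix_shift {m n : ℕ} (s : ℕ) (hm : 3 ≤ m) (hs : s + m = n)
    (k : Fin m) :
    (extendMatrix (CartanMatrix.D n) (Pi.single ⟨s + k, by omega⟩ 1)).submatrix
      (Option.map fun i : Fin m => ⟨s + i, by omega⟩)
      (Option.map fun i : Fin m => ⟨s + i, by omega⟩) =
      extendMatrix (CartanMatrix.D m) (Pi.single k 1) := by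
  ext (_ | i) (_ | j) <;> simp only [CartanMatrix.D, Pi.single_apply, Fin.ext_iff,
    Matrix.of_apply, Matrix.submatrix_apply, Option.map_none, Option.map_some,
    extendMatrix_none_none, extendMatrix_none_some, extendMatrix_some_none,
    extendMatrix_some_some] <;> grind (splits := 30)

lemma injective_option_map_shift {m n : ℕ} (s : ℕ) (hs : s + m ≤ n) :
    Function.Injective
      (Option.map fun i : Fin m => (⟨s + i, by omega⟩ : Fin n)) :=
  Option.map_injective fun i j h => by simpa [Fin.ext_iff] using h

/-- The hypothesis on `k` makes the right arm, of length `n - 1 - k`, the shorter one. Length `0`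
gives `A`, length `1` gives `D`, length `2` gives `E₆`, `E₇`, `E₈` or contains affine `E₈`, and
greater length contains affine `E₇`. -/
lemma isSimplyLacedFinite_extendMatrix_A_of_le {n : ℕ} (k : Fin n) (hk : n ≤ 2 * k.val + 1)
    (hpos : StrictlyCopositive (extendMatrix (CartanMatrix.A n) (Pi.single k 1))) :
    IsSimplyLacedFinite (extendMatrix (CartanMatrix.A n) (Pi.single k 1)) := by
  obtain ⟨k, hkn⟩ := k
  simp only at hk
  by_cases h1 : k + 1 = n
  · exact isSimplyLacedFinite_extendMatrix_A_last _ h1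
  by_cases h2 : k + 2 = n
  · exact isSimplyLacedFinite_extendMatrix_A_penultimate (by omega) _ h2
  by_cases h3 : k + 3 = n
  · by_cases h8 : 8 ≤ n
    · have := hpos.submatrix (injective_option_map_shift (m := 8) (n - 8) (by omega))
      obtain rfl : k = n - 8 + (5 : Fin 8).val := by change k = n - 8 + 5; omega
      rw [extendMatrix_A_submatrix_shift (m := 8) (n - 8) (by omega) 5] at this
      exact (not_strictlyCopositive_extendMatrix_A_eight this).elim
    · obtain ⟨rfl, rfl⟩ | ⟨rfl, rfl⟩ | ⟨rfl, rfl⟩ :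
        (n = 5 ∧ k = 2) ∨ (n = 6 ∧ k = 3) ∨ (n = 7 ∧ k = 4) := by omega
      · exact isSimplyLacedFinite_extendMatrix_A_five
      · exact isSimplyLacedFinite_extendMatrix_A_six
      · exact isSimplyLacedFinite_extendMatrix_A_seven
  · obtain ⟨s, rfl⟩ : ∃ s, k = s + (3 : Fin 7).val := ⟨k - 3, by change k = k - 3 + 3; omega⟩
    have hs : s + 7 ≤ n := by change s + 3 < n at hkn; change ¬ s + 3 + 3 = n at h3; grind
    have := hpos.submatrix (injective_option_map_shift s hs)
    rw [extendMatrix_A_submatrix_shift s hs 3] at this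
    exact (not_strictlyCopositive_extendMatrix_A_seven this).elim

lemma cartanMatrix_A_rev {n : ℕ} (i j : Fin n) :
    CartanMatrix.A n (Fin.revPerm i) (Fin.revPerm j) = CartanMatrix.A n i j := by
  simp only [CartanMatrix.A, Matrix.of_apply, Fin.ext_iff, Fin.revPerm_apply, Fin.val_rev]
  grind

lemma isSimplyLacedFinite_extendMatrix_of_automorphism {n : ℕ}
    {C : Matrix (Fin n) (Fin n) ℤ} (τ : Fin n ≃ Fin n) (hτ : ∀ i j, C (τ i) (τ j) = C i j)
    (k : Fin n)
    (h : StrictlyCopositive (extendMatrix C (Pi.single k 1)) →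
      IsSimplyLacedFinite (extendMatrix C (Pi.single k 1)))
    (hpos : StrictlyCopositive (extendMatrix C (Pi.single (τ k) 1))) :
    IsSimplyLacedFinite (extendMatrix C (Pi.single (τ k) 1)) := by
  have h' := extendMatrix_submatrix_optionCongr C τ hτ k
  refine .of_submatrix τ.optionCongr ?_
  rw [h']
  exact h (h' ▸ hpos.submatrix τ.optionCongr.injective)

lemma isSimplyLacedFinite_extendMatrix_A {n : ℕ} (k : Fin n)
    (hpos : StrictlyCopositive (extendMatrix (CartanMatrix.A n) (Pi.single k 1))) :
    IsSimplyLacedFinite (extendMatrix (CartanMatrix.A n) (Pi.single k 1)) := by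
  by_cases hk : n ≤ 2 * k.val + 1
  · exact isSimplyLacedFinite_extendMatrix_A_of_le k hk hpos
  · obtain ⟨k, rfl⟩ := Fin.revPerm.surjective k
    refine isSimplyLacedFinite_extendMatrix_of_automorphism _ cartanMatrix_A_rev k ?_ hpos
    refine isSimplyLacedFinite_extendMatrix_A_of_le k ?_
    simp only [Fin.revPerm_apply, Fin.val_rev] at hk
    omega

lemma isSimplyLacedFinite_extendMatrix_D_first {n : ℕ} (hn : 4 ≤ n) (k : Fin n)
    (hk : k.val = 0) :
    IsSimplyLacedFinite (extendMatrix (CartanMatrix.D n) (Pi.single k 1)) := by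
  rw [show k = ⟨0, by omega⟩ from Fin.ext hk]
  exact (isSimplyLacedFinite_D (by omega)).of_equiv (finSuccEquiv n)
    (cartanMatrix_D_succ (by omega))

/-- Lengthening a leg of the fork gives `D₅`, `E₆`, `E₇`, `E₈` for `n = 4, 5, 6, 7`; from `n = 8`
on, affine `E₈` appears. -/
lemma isSimplyLacedFinite_extendMatrix_D_last {n : ℕ} (hn : 4 ≤ n) (k : Fin n)
    (hk : k.val + 1 = n)
    (hpos : StrictlyCopositive (extendMatrix (CartanMatrix.D n) (Pi.single k 1))) :
    IsSimplyLacedFinite (extendMatrix (CartanMatrix.D n) (Pi.single k 1)) := by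
  obtain ⟨k, hkn⟩ := k
  simp only at hk
  by_cases h8 : 8 ≤ n
  · have := hpos.submatrix (injective_option_map_shift (m := 8) (n - 8) (by omega))
    obtain rfl : k = n - 8 + (7 : Fin 8).val := by change k = n - 8 + 7; omega
    rw [extendMatrix_D_submatrix_shift (m := 8) (n - 8) (by omega) (by omega) 7] at this
    exact (not_strictlyCopositive_extendMatrix_D_eight this).elim
  · obtain ⟨rfl, rfl⟩ | ⟨rfl, rfl⟩ | ⟨rfl, rfl⟩ | ⟨rfl, rfl⟩ :
      (n = 4 ∧ k = 3) ∨ (n = 5 ∧ k = 4) ∨ (n = 6 ∧ k = 5) ∨ (n = 7 ∧ k = 6) := by omega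
    · exact isSimplyLacedFinite_extendMatrix_D_four
    · exact isSimplyLacedFinite_extendMatrix_D_five
    · exact isSimplyLacedFinite_extendMatrix_D_six
    · exact isSimplyLacedFinite_extendMatrix_D_seven

lemma cartanMatrix_D_swap {n : ℕ} (k l : Fin n) (hk : k.val + 1 = n) (hl : l.val + 2 = n)
    (i j : Fin n) :
    CartanMatrix.D n (Equiv.swap k l i) (Equiv.swap k l j) = CartanMatrix.D n i j := by
  simp only [CartanMatrix.D, Matrix.of_apply, Equiv.swap_apply_def]
  grind (splits := 30)

lemma isSimplyLacedFinite_extendMatrix_D {n : ℕ} (hn : 4 ≤ n) (k : Fin n)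
    (hk : k.val = 0 ∨ n ≤ k.val + 2)
    (hpos : StrictlyCopositive (extendMatrix (CartanMatrix.D n) (Pi.single k 1))) :
    IsSimplyLacedFinite (extendMatrix (CartanMatrix.D n) (Pi.single k 1)) := by
  obtain hk | hk | hk : k.val = 0 ∨ k.val + 1 = n ∨ k.val + 2 = n := by omega
  · exact isSimplyLacedFinite_extendMatrix_D_first hn k hk
  · exact isSimplyLacedFinite_extendMatrix_D_last hn k hk hpos
  · let l : Fin n := ⟨n - 1, by omega⟩
    have hl : l.val + 1 = n := Nat.sub_add_cancel (by omega)
    have hkl : Equiv.swap l k l = k := Equiv.swap_apply_left l k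
    rw [← hkl] at hpos ⊢
    exact isSimplyLacedFinite_extendMatrix_of_automorphism _ (cartanMatrix_D_swap l k hl hk) l
      (isSimplyLacedFinite_extendMatrix_D_last hn l hl) hpos

lemma isSimplyLacedFinite_extendMatrix_E₆_of_mem {k : Fin 6} (hk : k = 0 ∨ k = 5) :
    IsSimplyLacedFinite (extendMatrix CartanMatrix.E₆ (Pi.single k 1)) := by
  rcases hk with rfl | rfl
  · refine isSimplyLacedFinite_E₇.of_bijective
      ![some 5, some 1, some 4, some 3, some 2, some 0, none]
      (by decide) (by decide)
  · exact isSimplyLacedFinite_extendMatrix_E₆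

/-- Adding a vertex to a connected simply laced diagram of finite type, joined by simple edges to at
least one old vertex, gives again a diagram of finite type as long as it stays strictly
copositive. -/
theorem isSimplyLacedFinite_extendMatrix (X : SimplyLacedType) {a : Fin X.rank → ℤ}
    (ha : ∀ i, a i = 0 ∨ a i = 1) (ha0 : a ≠ 0)
    (hpos : StrictlyCopositive (extendMatrix X.cartanMatrix a)) :
    IsSimplyLacedFinite (extendMatrix X.cartanMatrix a) := by
  cases X with
  | A n hn =>
    obtain ⟨n, rfl⟩ : ∃ m, n = m + 1 := ⟨n - 1, by omega⟩
    obtain ⟨k, -, rfl⟩ := eq_single_of_sum_mul_le_one (h := 1) ha ha0 (fun _ => le_rfl)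
      (hpos.sum_mul_le_one (fun _ => zero_le_one) (quadForm_A_one n))
    exact isSimplyLacedFinite_extendMatrix_A k hpos
  | D n hn =>
    have h1 : ∀ i : Fin n, (1 : ℤ) ≤ if i.val ≠ 0 ∧ i.val + 2 < n then 2 else 1 := fun i => by
      split_ifs <;> norm_num
    obtain ⟨k, hk, rfl⟩ := eq_single_of_sum_mul_le_one ha ha0 h1
      (hpos.sum_mul_le_one (fun i => zero_le_one.trans (h1 i)) (quadForm_D_highestRoot hn))
    refine isSimplyLacedFinite_extendMatrix_D hn k ?_ hpos
    by_contra hk'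
    rw [if_pos (by omega)] at hk
    norm_num at hk
  | E₆ =>
    have h1 : ∀ i : Fin 6, (1 : ℤ) ≤ ![1, 2, 2, 3, 2, 1] i := by decide
    have h2 : quadForm CartanMatrix.E₆ ![1, 2, 2, 3, 2, 1] = 2 := by decide
    obtain ⟨k, hk, rfl⟩ := eq_single_of_sum_mul_le_one ha ha0 h1
      (hpos.sum_mul_le_one (fun i => zero_le_one.trans (h1 i)) h2)
    have : ∀ k : Fin 6, ![(1 : ℤ), 2, 2, 3, 2, 1] k = 1 → k = 0 ∨ k = 5 := by decide
    exact isSimplyLacedFinite_extendMatrix_E₆_of_mem (this k hk)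
  | E₇ =>
    have h1 : ∀ i : Fin 7, (1 : ℤ) ≤ ![2, 2, 3, 4, 3, 2, 1] i := by decide
    have h2 : quadForm CartanMatrix.E₇ ![2, 2, 3, 4, 3, 2, 1] = 2 := by decide
    obtain ⟨k, hk, rfl⟩ := eq_single_of_sum_mul_le_one ha ha0 h1
      (hpos.sum_mul_le_one (fun i => zero_le_one.trans (h1 i)) h2)
    have : ∀ k : Fin 7, ![(2 : ℤ), 2, 3, 4, 3, 2, 1] k = 1 → k = 6 := by decide
    obtain rfl := this k hk
    exact isSimplyLacedFinite_extendMatrix_E₇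
  | E₈ =>
    -- The highest root of `E₈` has no coefficient `1`, so no vertex can be attached.
    have h1 : ∀ i : Fin 8, (1 : ℤ) ≤ ![2, 3, 4, 6, 5, 4, 3, 2] i := by decide
    have h2 : quadForm CartanMatrix.E₈ ![2, 3, 4, 6, 5, 4, 3, 2] = 2 := by decide
    obtain ⟨k, hk, rfl⟩ := eq_single_of_sum_mul_le_one ha ha0 h1
      (hpos.sum_mul_le_one (fun i => zero_le_one.trans (h1 i)) h2)
    have : ∀ k : Fin 8, ![(2 : ℤ), 3, 4, 6, 5, 4, 3, 2] k ≠ 1 := by decide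
    exact (this k hk).elim

end Extension

/-! ### Screeners, their reflections, and short screeners -/

section Screeners

variable {L : Type*} [AddCommGroup L] {B : LinearMap.BilinForm ℤ L}

lemma IsPosDefEven.eq_zero_of_nonpos (hB : IsPosDefEven B) {x : L} (h : B x x ≤ 0) : x = 0 :=
  not_not.1 fun hx => not_lt.2 h (hB.pos x hx)

lemma ne_zero_of_mem_screeners {x : L} (hx : x ∈ screeners B) : x ≠ 0 := by
  rintro rfl
  exact hx.2.1 ⟨0, by simp⟩

lemma mem_dualLattice_iff (hB : IsPosDefEven B) {x : L} (hx : x ≠ 0) :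
    (2 / ((B x x : ℤ) : ℚ)) ⊗ₜ[ℤ] x ∈ dualLattice B ↔ ∀ y, B x x ∣ 2 * B x y := by
  have h0 : ((B x x : ℤ) : ℚ) ≠ 0 := by exact_mod_cast (hB.pos x hx).ne'
  refine forall_congr' fun y => exists_congr fun n => ?_
  rw [LinearMap.BilinForm.baseChange_tmul, hB.symm y x, zsmul_eq_mul, one_mul, mul_div_assoc',
    div_eq_iff h0]
  norm_cast
  rw [mul_comm (B x y), mul_comm n]

/-- The norm condition is automatic in an even lattice, and the dual lattice condition becomes
integrality of the Cartan numbers. -/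
lemma mem_screeners_iff (hB : IsPosDefEven B) {x : L} :
    x ∈ screeners B ↔ (¬ ∃ z : L, x = (2 : ℤ) • z) ∧ ∀ y, B x x ∣ 2 * B x y := by
  constructor
  · intro hx
    exact ⟨hx.2.1, (mem_dualLattice_iff hB (ne_zero_of_mem_screeners hx)).1 hx.2.2⟩
  · rintro ⟨h1, h2⟩
    have hx : x ≠ 0 := by
      rintro rfl
      exact h1 ⟨0, by simp⟩
    exact ⟨hB.even x, h1, (mem_dualLattice_iff hB hx).2 h2⟩

lemma neg_mem_screeners (hB : IsPosDefEven B) {x : L} (hx : x ∈ screeners B) :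
    -x ∈ screeners B := by
  rw [mem_screeners_iff hB] at hx ⊢
  refine ⟨fun ⟨z, hz⟩ => hx.1 ⟨-z, by rw [smul_neg, ← hz, neg_neg]⟩, fun y => ?_⟩
  simpa using hx.2 y

lemma norm_sub_zsmul_of_pairing (hB : IsPosDefEven B) {x y : L} {k : ℤ}
    (hk : 2 * B x y = B x x * k) : B (y - k • x) (y - k • x) = B y y := by
  simp only [map_sub, map_smul, LinearMap.sub_apply, LinearMap.smul_apply, smul_eq_mul]
  rw [hB.symm y x]
  linear_combination (-k) * hk

/-- The image of a screener under the reflection in a screener is a screener. -/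
lemma sub_zsmul_mem_screeners (hB : IsPosDefEven B) {x y : L} (hx : x ∈ screeners B)
    (hy : y ∈ screeners B) {k : ℤ} (hk : 2 * B x y = B x x * k) : y - k • x ∈ screeners B := by
  have hx0 := hB.pos x (ne_zero_of_mem_screeners hx)
  rw [mem_screeners_iff hB] at hx hy ⊢
  refine ⟨fun ⟨z, hz⟩ => hy.1 ?_, fun w => ?_⟩
  · obtain ⟨c, hc⟩ := hx.2 z
    refine ⟨z - c • x, ?_⟩
    -- Pairing `y - k • x = 2 • z` with `x` shows that `k` is even, so `y` itself would lie in `2L`.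
    have h1 : B x (y - k • x) = B x ((2 : ℤ) • z) := by rw [hz]
    simp only [map_sub, map_smul, smul_eq_mul] at h1
    have h2 : k = -(2 * c) := by
      apply mul_left_cancel₀ hx0.ne'
      linear_combination hk - 2 * h1 - 2 * hc
    rw [sub_eq_iff_eq_add] at hz
    rw [hz, h2, smul_sub, smul_smul, neg_smul, sub_eq_add_neg]
  · obtain ⟨m, hm⟩ := hx.2 w
    rw [norm_sub_zsmul_of_pairing hB hk]
    convert! hy.2 (w - m • x) using 1
    simp only [map_sub, map_smul, LinearMap.sub_apply, LinearMap.smul_apply, smul_eq_mul]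
    rw [hB.symm y x]
    linear_combination (-k) * hm + m * hk

/-- Two distinct screeners at an acute angle: the longer one pairs to `1` with the shorter one. -/
lemma two_mul_eq_of_pos (hB : IsPosDefEven B) {x y : L} (hy : y ∈ screeners B)
    (hne : x ≠ y) (hpos : 0 < B x y) (hle : B x x ≤ B y y) : 2 * B x y = B y y := by
  have hy0 := hB.pos y (ne_zero_of_mem_screeners hy)
  obtain ⟨b, hb⟩ := ((mem_screeners_iff hB).1 hy).2 x
  rw [hB.symm y x] at hb
  have hb0 : 0 < b := by
    by_contra h
    nlinarith
  -- If `b ≥ 2`, then `B x x ≤ B y y ≤ B x y`, so `x - y` has nonpositive norm.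
  have hb1 : b = 1 := by
    by_contra h
    refine hne (sub_eq_zero.1 (hB.eq_zero_of_nonpos ?_))
    simp only [map_sub, LinearMap.sub_apply]
    rw [hB.symm y x]
    have : B y y * 2 ≤ B y y * b := mul_le_mul_of_nonneg_left (by omega) hy0.le
    linarith
  rw [hb, hb1, mul_one]

/-- The screeners that are no longer than any screener not orthogonal to them. -/
def shortScreeners (B : LinearMap.BilinForm ℤ L) : Set L :=
  {x ∈ screeners B | ∀ y ∈ screeners B, B x y ≠ 0 → B x x ≤ B y y}

lemma neg_mem_shortScreeners (hB : IsPosDefEven B) {x : L} (hx : x ∈ shortScreeners B) :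
    -x ∈ shortScreeners B :=
  ⟨neg_mem_screeners hB hx.1, fun y hy hxy => by simpa using hx.2 y hy (by simpa using hxy)⟩

lemma ne_zero_of_mem_shortScreeners {x : L} (hx : x ∈ shortScreeners B) : x ≠ 0 :=
  ne_zero_of_mem_screeners hx.1

lemma norm_eq_of_mem_shortScreeners (hB : IsPosDefEven B) {x y : L} (hx : x ∈ shortScreeners B)
    (hy : y ∈ shortScreeners B) (hxy : B x y ≠ 0) : B x x = B y y :=
  le_antisymm (hx.2 y hy.1 hxy) (hy.2 x hx.1 (hB.symm x y ▸ hxy))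

lemma two_mul_eq_of_mem_shortScreeners (hB : IsPosDefEven B) {x y : L}
    (hx : x ∈ shortScreeners B) (hy : y ∈ shortScreeners B) (hne : x ≠ y) (hpos : 0 < B x y) :
    2 * B x y = B y y :=
  two_mul_eq_of_pos hB hy.1 hne hpos (norm_eq_of_mem_shortScreeners hB hx hy hpos.ne').le

/-- The difference is the mirror image of `x` in `y`. A screener not orthogonal to it is not
orthogonal to `x` or to `y`, and these have the same norm. -/
lemma sub_mem_shortScreeners (hB : IsPosDefEven B) {x y : L}
    (hx : x ∈ shortScreeners B) (hy : y ∈ shortScreeners B) (hne : x ≠ y) (hpos : 0 < B x y) :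
    x - y ∈ shortScreeners B := by
  have h2 : 2 * B y x = B y y * 1 := by
    rw [hB.symm y x, mul_one, two_mul_eq_of_mem_shortScreeners hB hx hy hne hpos]
  have hn := norm_sub_zsmul_of_pairing hB h2
  have hm := sub_zsmul_mem_screeners hB hy.1 hx.1 h2
  rw [one_smul] at hn hm
  refine ⟨hm, fun z hz hxyz => ?_⟩
  rw [hn]
  by_cases hxz : B x z = 0
  · rw [norm_eq_of_mem_shortScreeners hB hx hy hpos.ne']
    refine hy.2 z hz fun hyz => hxyz ?_
    simp [hxz, hyz]
  · exact hx.2 z hz hxz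

/-- By induction on the norm: a screener `x` that is not short is the difference of the strictly
shorter screeners `y` and `y - x`. -/
lemma screeners_subset_span_shortScreeners (hB : IsPosDefEven B) :
    screeners B ⊆ Submodule.span ℤ (shortScreeners B) := by
  suffices h : ∀ n : ℕ, ∀ x ∈ screeners B, (B x x).toNat = n →
      x ∈ Submodule.span ℤ (shortScreeners B) from fun x hx => h _ x hx rfl
  intro n
  induction n using Nat.strong_induction_on with
  | _ n ih =>
    intro x hx hn
    by_cases hs : x ∈ shortScreeners B
    · exact Submodule.subset_span hs
    obtain ⟨y, hy, hxy, hlt⟩ : ∃ y ∈ screeners B, B x y ≠ 0 ∧ B y y < B x x := by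
      by_contra! h
      exact hs ⟨hx, h⟩
    obtain ⟨y, hy, hxy, hlt⟩ : ∃ y ∈ screeners B, 0 < B x y ∧ B y y < B x x := by
      rcases lt_or_gt_of_ne hxy with h | h
      · exact ⟨-y, neg_mem_screeners hB hy, by simpa using h, by simpa using hlt⟩
      · exact ⟨y, hy, h, hlt⟩
    have h2 := two_mul_eq_of_pos hB hx (by rintro rfl; exact lt_irrefl _ hlt)
      (hB.symm x y ▸ hxy) hlt.le
    rw [hB.symm y x, ← mul_one (B x x)] at h2
    have hn' := norm_sub_zsmul_of_pairing hB h2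
    have hm' := sub_zsmul_mem_screeners hB hx hy h2
    rw [one_smul] at hn' hm'
    have hy0 := hB.pos y (ne_zero_of_mem_screeners hy)
    have h3 := ih (B y y).toNat (by omega) y hy rfl
    have h4 := ih (B y y).toNat (by omega) (y - x) hm' (by rw [hn'])
    have := Submodule.sub_mem _ h3 h4
    rwa [sub_sub_cancel] at this

/-- Short screeners that are congruent modulo `5` are equal. -/
lemma eq_of_sub_eq_five_smul (hB : IsPosDefEven B) {x y z : L} (hx : x ∈ shortScreeners B)
    (hy : y ∈ shortScreeners B) (h : x - y = (5 : ℤ) • z) : x = y := by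
  by_contra hne
  have hx0 := hB.pos x (ne_zero_of_mem_shortScreeners hx)
  obtain ⟨m, hm⟩ := ((mem_screeners_iff hB).1 hx.1).2 z
  have h1 : B x (x - y) = 5 * B x z := by rw [h]; simp
  rw [map_sub] at h1
  have h2 : 2 * B x y = B x x * (2 - 5 * m) := by linear_combination (-5) * hm - 2 * h1
  have hcancel : ∀ k : ℤ, 2 * B x y = B x x * k → 2 - 5 * m = k := fun k hk =>
    mul_left_cancel₀ hx0.ne' (h2.symm.trans hk)
  -- The Cartan number of `x` and `y` is `2 - 5 * m`. For distinct short screeners it is `-2`, `-1`,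
  -- `0` or `1`, none of which is congruent to `2` modulo `5`; modulo `3` or `4` one of them would
  -- be.
  rcases lt_trichotomy (B x y) 0 with hlt | heq | hgt
  · by_cases hxy : x = -y
    · have := hcancel (-2) (by rw [hxy]; simp; ring)
      omega
    · have := two_mul_eq_of_mem_shortScreeners hB hx (neg_mem_shortScreeners hB hy) hxy
        (by simpa using hlt)
      simp only [map_neg, LinearMap.neg_apply, neg_neg] at this
      rw [← norm_eq_of_mem_shortScreeners hB hx hy hlt.ne] at this
      have := hcancel (-1) (by linarith)
      omega
  · have := hcancel 0 (by simp [heq])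
    omega
  · have := two_mul_eq_of_mem_shortScreeners hB hx hy hne hgt
    rw [← norm_eq_of_mem_shortScreeners hB hx hy hgt.ne'] at this
    have := hcancel 1 (by linarith)
    omega

lemma finite_shortScreeners [Module.Free ℤ L] [Module.Finite ℤ L] (hB : IsPosDefEven B) :
    (shortScreeners B).Finite := by
  let b := Module.Free.chooseBasis ℤ L
  let r : L → (Module.Free.ChooseBasisIndex ℤ L → ZMod 5) := fun x j => (b.repr x j : ZMod 5)
  refine Set.Finite.of_finite_image (f := r) (Set.toFinite _) fun x hx y hy hxy => ?_
  have hdvd : ∀ j, ∃ c, b.repr x j - b.repr y j = 5 * c := fun j => by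
    have := (ZMod.intCast_eq_intCast_iff_dvd_sub (b.repr y j) (b.repr x j) 5).1
      (congrFun hxy j).symm
    exact_mod_cast this
  choose c hc using hdvd
  refine eq_of_sub_eq_five_smul (z := ∑ j, c j • b j) hB hx hy ?_
  refine b.ext_elem fun j => ?_
  rw [map_sub, Finsupp.sub_apply, hc, map_smul, Finsupp.smul_apply, b.repr_sum_self, smul_eq_mul]

/-- A finite set of nonzero vectors of a lattice is avoided by the kernel of some integral
functional. -/
lemma exists_dual_apply_ne_zero [Module.Free ℤ L] [Module.Finite ℤ L] {s : Set L}
    (hs : s.Finite) (h0 : (0 : L) ∉ s) : ∃ f : Module.Dual ℤ L, ∀ x ∈ s, f x ≠ 0 := by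
  let b := Module.Free.chooseBasis ℤ L
  have := hs.to_subtype
  obtain ⟨φ, hφ⟩ := Module.exists_dual_forall_apply_ne_zero (K := ℚ)
    (fun (x : s) (j : Module.Free.ChooseBasisIndex ℤ L) => (b.repr (x : L) j : ℚ)) fun x hx => by
      refine h0 ?_
      have : (x : L) = 0 := b.ext_elem fun j => by simpa using congrFun hx j
      exact this ▸ x.2
  -- A common denominator `N` of the values of `φ` on coordinate vectors makes `N • φ` integral on
  -- `L`.
  obtain ⟨⟨N, hN⟩, hint⟩ := IsLocalization.exist_integer_multiples_of_finite (S := ℚ)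
    (nonZeroDivisors ℤ)
    fun j : Module.Free.ChooseBasisIndex ℤ L => φ (Pi.single j 1)
  choose c hc using hint
  refine ⟨b.constr ℤ c, fun x hx hfx => hφ ⟨x, hx⟩ ?_⟩
  have hN0 : (N : ℚ) ≠ 0 := Int.cast_ne_zero.2 (nonZeroDivisors.ne_zero hN)
  have key : (N : ℚ) * φ (fun j => (b.repr x j : ℚ)) = ((b.constr ℤ c x : ℤ) : ℚ) := by
    rw [LinearMap.pi_apply_eq_sum_univ φ, b.constr_apply_fintype ℤ, Finset.mul_sum]
    push_cast
    refine Finset.sum_congr rfl fun j _ => ?_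
    have := hc j
    simp only [algebraMap_int_eq, eq_intCast] at this
    simp only [smul_eq_mul, Int.cast_mul, Module.Basis.equivFun_apply, this]
    have h1 : (fun i => if j = i then (1 : ℚ) else 0) = Pi.single j 1 := by
      ext i; simp [Pi.single_apply, eq_comm]
    rw [h1, zsmul_eq_mul]
    ring
  rw [hfx, Int.cast_zero] at key
  exact (mul_eq_zero.1 key).resolve_left hN0

end Screeners

namespace SimplyLacedType

lemma cartanMatrix_self (X : SimplyLacedType) (i : Fin X.rank) : X.cartanMatrix i i = 2 := by
  cases X with
  | A n hn => exact congrFun (CartanMatrix.A_diag n) i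
  | D n hn => exact CartanMatrix.D_diag n i
  | E₆ => exact CartanMatrix.E₆_diag i
  | E₇ => exact CartanMatrix.E₇_diag i
  | E₈ => exact CartanMatrix.E₈_diag i

lemma cartanMatrix_nonpos (X : SimplyLacedType) {i j : Fin X.rank} (h : i ≠ j) :
    X.cartanMatrix i j ≤ 0 := by
  cases X with
  | A n hn => exact CartanMatrix.A_apply_le_zero_of_ne n i j h
  | D n hn => exact CartanMatrix.D_off_diag_nonpos n i j h
  | E₆ => exact CartanMatrix.E₆_off_diag_nonpos i j h
  | E₇ => exact CartanMatrix.E₇_off_diag_nonpos i j h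
  | E₈ => exact CartanMatrix.E₈_off_diag_nonpos i j h

end SimplyLacedType

/-! ### Simple systems of short screeners -/

variable {L : Type*} [AddCommGroup L] {B : LinearMap.BilinForm ℤ L}

/-- A set of vectors on the positive side of a functional, any two of which are orthogonal or
have equal length and form an angle of `2π / 3`. -/
structure IsSimplyLacedSystem (B : LinearMap.BilinForm ℤ L) (f : Module.Dual ℤ L) (Δ : Set L) :
    Prop where
  pos : ∀ x ∈ Δ, 0 < f x
  pairing : ∀ x ∈ Δ, ∀ y ∈ Δ, x ≠ y → B x y = 0 ∨ (B x x = B y y ∧ 2 * B x y = -B x x)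

section SimpleSystem

lemma IsSimplyLacedSystem.linearIndependent (hB : IsPosDefEven B) {f : Module.Dual ℤ L}
    {Δ : Set L} (hΔ : IsSimplyLacedSystem B f Δ) :
    LinearIndependent ℤ (Subtype.val : Δ → L) := by
  refine LinearMap.BilinForm.linearIndependent_of_pairwise_le_zero B
    (fun x hx => hB.pos x hx) f _ (fun x => hΔ.pos x x.2) fun x y hxy => ?_
  rcases hΔ.pairing x x.2 y y.2 (Subtype.coe_injective.ne hxy) with h | h
  · exact h.le
  · have : 0 ≤ B (x : L) x := by
      by_cases hx : (x : L) = 0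
      · simp [hx]
      · exact (hB.pos _ hx).le
    linarith [h.2]

/-- The short screeners have a simple system. -/
lemma exists_isSimplyLacedSystem [Module.Free ℤ L] [Module.Finite ℤ L] (hB : IsPosDefEven B) :
    ∃ (f : Module.Dual ℤ L) (Δ : Set L), IsSimplyLacedSystem B f Δ ∧ Δ ⊆ shortScreeners B ∧
      Submodule.span ℤ Δ = Submodule.span ℤ (shortScreeners B) := by
  have hfin := finite_shortScreeners hB
  obtain ⟨f, hf⟩ := exists_dual_apply_ne_zero hfin fun h => ne_zero_of_mem_shortScreeners h rfl
  have := hfin.to_subtype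
  let _ : InvolutiveNeg (shortScreeners B) :=
    { neg := fun x => ⟨-x, neg_mem_shortScreeners hB x.2⟩
      neg_neg := fun x => Subtype.ext (neg_neg (x : L)) }
  have hneg : ∀ x : shortScreeners B, ((-x : shortScreeners B) : L) = -(x : L) := fun _ => rfl
  have hf' : ∀ x : shortScreeners B, (f : L →+ ℤ) x ≠ 0 := fun x => hf x x.2
  let base := IsAddIndecomposable.baseOf (Subtype.val : shortScreeners B → L) (f : L →+ ℤ)
  have hpos : ∀ x ∈ base, 0 < f (x : L) := fun x hx => hx.1
  refine ⟨f, Subtype.val '' base, ⟨?_, ?_⟩, ?_, ?_⟩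
  · rintro _ ⟨x, hx, rfl⟩
    exact hpos x hx
  · rintro _ ⟨x, hx, rfl⟩ _ ⟨y, hy, rfl⟩ hxy
    rcases lt_trichotomy (B (x : L) y) 0 with hlt | heq | hgt
    · right
      have hn := norm_eq_of_mem_shortScreeners hB x.2 y.2 hlt.ne
      refine ⟨hn, ?_⟩
      have hne : (x : L) ≠ -y := fun h => by
        have h1 := hpos x hx
        have h2 := hpos y hy
        rw [h, map_neg] at h1
        linarith
      have := two_mul_eq_of_mem_shortScreeners hB x.2 (neg_mem_shortScreeners hB y.2) hne
        (by simpa using hlt)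
      simp only [map_neg, LinearMap.neg_apply, neg_neg] at this
      linarith
    · exact .inl heq
    -- At an acute angle `x - y` would be a short screener, against the indecomposability of `x` and
    -- `y`.
    · refine (IsAddIndecomposable.pairwise_baseOf_sub_notMem _ hneg (f : L →+ ℤ) hf' hx hy
        (fun h => hxy (h ▸ rfl)) ?_).elim
      exact ⟨⟨_, sub_mem_shortScreeners hB x.2 y.2 hxy hgt⟩, rfl⟩
  · rintro _ ⟨x, -, rfl⟩
    exact x.2
  · apply Submodule.toAddSubgroup_injective
    have := AddSubgroup.closure_image_isAddIndecomposable_baseOf _ hneg (f : L →+ ℤ) hf'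
    rw [Subtype.range_coe] at this
    rw [Submodule.span_int_eq_addSubgroupClosure, Submodule.span_int_eq_addSubgroupClosure]
    exact this

end SimpleSystem

/-! ### Splitting a simply laced system into ADE diagrams -/

section Diagrams

lemma bilin_sum_smul {ι : Type*} [Fintype ι] {M : Matrix ι ι ℤ} {g : ι → L} {p : ℤ}
    (hg : ∀ i j, B (g i) (g j) = p * M i j) (x y : ι → ℤ) :
    B (∑ i, x i • g i) (∑ j, y j • g j) = p * ∑ i, ∑ j, x i * y j * M i j := by
  simp only [map_sum, map_smul, LinearMap.sum_apply, LinearMap.smul_apply, smul_eq_mul, hg,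
    Finset.mul_sum]
  rw [Finset.sum_comm]
  exact Finset.sum_congr rfl fun i _ => Finset.sum_congr rfl fun j _ => by ring

/-- A matrix that is realized, up to a positive factor, as the Gram matrix of vectors on the
positive side of a functional is strictly copositive. -/
lemma strictlyCopositive_of_gram (hB : IsPosDefEven B) {f : Module.Dual ℤ L} {ι : Type*}
    [Fintype ι] {M : Matrix ι ι ℤ} {g : ι → L} {p : ℤ} (hp : 0 < p) (hf : ∀ i, 0 < f (g i))
    (hg : ∀ i j, B (g i) (g j) = p * M i j) : StrictlyCopositive M := by
  intro c hc hc0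
  refine pos_of_mul_pos_right (a := p) ?_ hp.le
  rw [quadForm, ← bilin_sum_smul hg]
  -- A nonzero nonnegative combination of the `g i` is nonzero because `f` is positive on it;
  -- independence of `g` is not needed.
  refine hB.pos _ fun h => ?_
  obtain ⟨k, hk⟩ := Function.ne_iff.1 hc0
  have h1 : 0 < ∑ i, c i * f (g i) :=
    Finset.sum_pos' (fun i _ => mul_nonneg (hc i) (hf i).le)
      ⟨k, Finset.mem_univ k, mul_pos (lt_of_le_of_ne (hc k) (Ne.symm hk)) (hf k)⟩
  have h2 : f (∑ i, c i • g i) = ∑ i, c i * f (g i) := by simp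
  rw [← h2, h, map_zero] at h1
  exact lt_irrefl _ h1

/-- The family `e` of vectors from `s` is a copy of the simple roots of type `X`, with the form
multiplied by `p`. -/
structure IsDiagram (B : LinearMap.BilinForm ℤ L) (s : Set L) (X : SimplyLacedType) (p : ℕ)
    (e : Fin X.rank → L) : Prop where
  scale_pos : 0 < p
  mem : ∀ i, e i ∈ s
  gram : ∀ i j, B (e i) (e j) = p * X.cartanMatrix i j

namespace IsDiagram

variable {s : Set L} {X : SimplyLacedType} {p : ℕ} {e : Fin X.rank → L}

lemma mono {t : Set L} (h : IsDiagram B s X p e) (hst : s ⊆ t) : IsDiagram B t X p e :=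
  ⟨h.scale_pos, fun i => hst (h.mem i), h.gram⟩

lemma injective (h : IsDiagram B s X p e) : Function.Injective e := by
  intro i j hij
  by_contra hne
  have h1 := h.gram i j
  rw [← hij, h.gram i i, X.cartanMatrix_self] at h1
  have hp : (0 : ℤ) < p := by exact_mod_cast h.scale_pos
  have := mul_nonpos_of_nonneg_of_nonpos hp.le (X.cartanMatrix_nonpos hne)
  linarith

/-- A diagram can be enlarged by any vertex joined to it. -/
lemma exists_extension (hB : IsPosDefEven B) {f : Module.Dual ℤ L}
    (hs : IsSimplyLacedSystem B f s) (h : IsDiagram B s X p e) {v : L} (hv : v ∈ s)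
    (hve : v ∉ Set.range e) {k : Fin X.rank} (hk : B v (e k) ≠ 0) :
    ∃ (X' : SimplyLacedType) (e' : Fin X'.rank → L), IsDiagram B s X' p e' ∧
      X'.rank = X.rank + 1 := by
  have hp : (0 : ℤ) < p := by exact_mod_cast h.scale_pos
  have hne : ∀ i, v ≠ e i := fun i hi => hve ⟨i, hi.symm⟩
  -- A neighbour of `e i` shares its norm `2 * p`, so the scale `p` carries over to the new vertex.
  have hpair : ∀ i, B v (e i) = 0 ∨ (B v v = 2 * p ∧ B v (e i) = -p) := fun i => by
    refine (hs.pairing v hv _ (h.mem i) (hne i)).imp_right fun ⟨h1, h2⟩ => ?_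
    rw [h.gram i i, X.cartanMatrix_self] at h1
    constructor <;> linarith
  have hvv : B v v = p * 2 := by
    rw [((hpair k).resolve_left hk).1, mul_comm]
  let a : Fin X.rank → ℤ := fun i => if B v (e i) = 0 then 0 else 1
  have ha : ∀ i, B v (e i) = p * -a i := fun i => by
    rcases hpair i with h0 | ⟨-, h1⟩
    · simp [a, h0]
    · simp [a, h1]
  let g : Option (Fin X.rank) → L := fun i => i.elim v e
  have hg : ∀ i j, B (g i) (g j) = p * extendMatrix X.cartanMatrix a i j := by
    rintro (_ | i) (_ | j)
    · exact hvv
    · exact ha j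
    · exact (hB.symm _ _).trans (ha i)
    · exact h.gram i j
  have hgs : ∀ i, g i ∈ s := by
    rintro (_ | i)
    exacts [hv, h.mem i]
  obtain ⟨X', σ, hX'⟩ := isSimplyLacedFinite_extendMatrix X (a := a)
    (fun i => by by_cases h : B v (e i) = 0 <;> simp [a, h])
    (fun h0 => by simpa [a, hk] using congrFun h0 k)
    (strictlyCopositive_of_gram hB hp (fun i => hs.pos _ (hgs i)) hg)
  refine ⟨X', g ∘ σ, ⟨h.scale_pos, fun i => hgs _, fun i j => ?_⟩, ?_⟩
  · rw [hX']
    exact hg _ _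
  · simpa using Fintype.card_congr σ

end IsDiagram

/-- The scale is half the norm of `x`, an integer because the lattice is even. -/
lemma exists_isDiagram_A_one (hB : IsPosDefEven B) {s : Set L} {x : L} (hx : x ∈ s)
    (hx0 : x ≠ 0) :
    ∃ (p : ℕ) (e : Fin (SimplyLacedType.A 1 le_rfl).rank → L),
      IsDiagram B s (.A 1 le_rfl) p e := by
  obtain ⟨k, hk⟩ := hB.even x
  have := hB.pos x hx0
  refine ⟨k.toNat, fun _ => x, by omega, fun _ => hx, fun i j => ?_⟩
  obtain rfl : i = j := Subsingleton.elim (α := Fin 1) i j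
  rw [SimplyLacedType.cartanMatrix_self]
  omega

/-- A nonempty finite simply laced system contains a diagram orthogonal to the rest. -/
lemma exists_isDiagram_orthogonal (hB : IsPosDefEven B) {f : Module.Dual ℤ L} {s : Set L}
    (hfin : s.Finite) (hs : IsSimplyLacedSystem B f s) (hne : s.Nonempty) :
    ∃ (X : SimplyLacedType) (p : ℕ) (e : Fin X.rank → L), IsDiagram B s X p e ∧
      0 < X.rank ∧ ∀ v ∈ s, v ∉ Set.range e → ∀ k, B v (e k) = 0 := by
  -- A diagram of greatest rank cannot be extended, so every other vertex is orthogonal to it.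
  let P : ℕ → Prop := fun n => ∃ (X : SimplyLacedType) (p : ℕ) (e : Fin X.rank → L),
    IsDiagram B s X p e ∧ X.rank = n
  have hbound : ∀ n, P n → n ≤ s.ncard := by
    rintro n ⟨X, p, e, h, rfl⟩
    have := Set.ncard_le_ncard (Set.range_subset_iff.2 h.mem) hfin
    rwa [← Set.image_univ, Set.ncard_image_of_injective _ h.injective, Set.ncard_univ,
      Nat.card_eq_fintype_card, Fintype.card_fin] at this
  obtain ⟨x, hx⟩ := hne
  obtain ⟨p₁, e₁, h₁⟩ := exists_isDiagram_A_one hB hx fun h0 => by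
    simpa [h0] using hs.pos x hx
  have hP1 : P 1 := ⟨_, p₁, e₁, h₁, rfl⟩
  classical
  have hle := Nat.le_findGreatest (hbound 1 hP1) hP1
  obtain ⟨X, p, e, h, hr⟩ := Nat.findGreatest_spec (hbound 1 hP1) hP1
  refine ⟨X, p, e, h, by omega, fun v hv hve k => ?_⟩
  by_contra hk
  obtain ⟨X', e', h', hr'⟩ := h.exists_extension hB hs hv hve hk
  have hP' : P X'.rank := ⟨X', p, e', h', rfl⟩
  have := Nat.le_findGreatest (hbound _ hP') hP'
  omega

/-- A finite simply laced system is an orthogonal union of diagrams of types `A_n`, `D_n`, `E₆`,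
`E₇`, `E₈`. -/
lemma exists_diagram_decomposition (hB : IsPosDefEven B) {f : Module.Dual ℤ L} {s : Set L}
    (hfin : s.Finite) (hs : IsSimplyLacedSystem B f s) :
    ∃ (m : ℕ) (K : Fin m → SimplyLacedType) (p : Fin m → ℕ)
      (e : ∀ i, Fin (K i).rank → L), (∀ i, IsDiagram B s (K i) (p i) (e i)) ∧
      (∀ i j, i ≠ j → ∀ k l, B (e i k) (e j l) = 0) ∧ ∀ x ∈ s, ∃ i k, e i k = x := by
  -- An arbitrary finite index type lets the induction add a component by passing to `Option ι`.
  suffices h : ∀ n (s : Set L), s.Finite → IsSimplyLacedSystem B f s → s.ncard = n →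
      ∃ (ι : Type) (_ : Fintype ι) (K : ι → SimplyLacedType) (p : ι → ℕ)
        (e : ∀ i, Fin (K i).rank → L), (∀ i, IsDiagram B s (K i) (p i) (e i)) ∧
        (∀ i j, i ≠ j → ∀ k l, B (e i k) (e j l) = 0) ∧ ∀ x ∈ s, ∃ i k, e i k = x by
    obtain ⟨ι, _, K, p, e, h1, h2, h3⟩ := h _ s hfin hs rfl
    let ε := (Fintype.equivFin ι).symm
    refine ⟨Fintype.card ι, K ∘ ε, p ∘ ε, fun i => e (ε i), fun i => h1 _,
      fun i j hij => h2 _ _ (ε.injective.ne hij), fun x hx => ?_⟩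
    obtain ⟨i, k, rfl⟩ := h3 x hx
    obtain ⟨i, rfl⟩ := ε.surjective i
    exact ⟨i, k, rfl⟩
  intro n
  induction n using Nat.strong_induction_on with
  | _ n ih =>
    intro s hfin hs hn
    rcases s.eq_empty_or_nonempty with rfl | hne
    · exact ⟨Empty, inferInstance, Empty.elim, Empty.elim, fun i => i.elim, fun i => i.elim,
        fun i => i.elim, fun x hx => hx.elim⟩
    obtain ⟨X, p₀, e₀, h₀, hr, horth⟩ := exists_isDiagram_orthogonal hB hfin hs hne
    have hlt : (s \ Set.range e₀).ncard < n := by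
      rw [← hn]
      exact Set.ncard_lt_ncard (Set.ssubset_iff_of_subset Set.sdiff_subset |>.2
        ⟨e₀ ⟨0, hr⟩, h₀.mem _, fun h => h.2 ⟨_, rfl⟩⟩) hfin
    obtain ⟨ι, _, K, p, e, h1, h2, h3⟩ :=
      ih _ hlt (s \ Set.range e₀) (hfin.subset Set.sdiff_subset)
      ⟨fun x hx => hs.pos x hx.1, fun x hx y hy => hs.pairing x hx.1 y hy.1⟩ rfl
    have horth' : ∀ i k l, B (e i k) (e₀ l) = 0 := fun i k l =>
      horth _ ((h1 i).mem k).1 ((h1 i).mem k).2 l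
    refine ⟨Option ι, inferInstance, fun i => i.elim X K, fun i => i.elim p₀ p,
      fun | none => e₀ | some i => e i, ?_, ?_, fun x hx => ?_⟩
    · rintro (_ | i)
      exacts [h₀, (h1 i).mono Set.sdiff_subset]
    · rintro (_ | i) (_ | j) hij k l
      · exact (hij rfl).elim
      · exact (hB.symm _ _).trans (horth' j l k)
      · exact horth' i k l
      · exact h2 i j (fun h => hij (h ▸ rfl)) k l
    · by_cases hx' : x ∈ Set.range e₀
      · obtain ⟨k, rfl⟩ := hx'
        exact ⟨none, k, rfl⟩
      · obtain ⟨i, k, hik⟩ := h3 x ⟨hx, hx'⟩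
        exact ⟨some i, k, hik⟩

end Diagrams

/-! ### Orthogonal sums and isometries -/

section Assembly

lemma bilin_eq_zero_of_mem_span {s t : Set L} (h : ∀ a ∈ s, ∀ b ∈ t, B a b = 0) {x y : L}
    (hx : x ∈ Submodule.span ℤ s) (hy : y ∈ Submodule.span ℤ t) : B x y = 0 := by
  have h1 : Submodule.span ℤ s ≤ LinearMap.ker (B.flip y) := by
    refine Submodule.span_le.2 fun a ha => ?_
    have h2 : Submodule.span ℤ t ≤ LinearMap.ker (B a) :=
      Submodule.span_le.2 fun b hb => h a ha b hb
    exact h2 hy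
  exact h1 hx

/-- A vector of `N i` lying in the sum of the other summands is orthogonal to itself, hence zero by
definiteness. -/
lemma isOrthogonalDirectSum_of_orthogonal (hB : IsPosDefEven B) {m : ℕ}
    {N : Fin m → Submodule ℤ L} (horth : ∀ i j, i ≠ j → ∀ x ∈ N i, ∀ y ∈ N j, B x y = 0)
    (hsup : ⨆ i, N i = ⊤) : IsOrthogonalDirectSum B N := by
  refine ⟨DirectSum.isInternal_submodule_of_iSupIndep_of_iSup_eq_top ?_ hsup, horth⟩
  refine iSupIndep_def.2 fun i => Submodule.disjoint_def.2 fun x hx hx' => ?_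
  have : ⨆ (j) (_ : j ≠ i), N j ≤ LinearMap.ker (B x) :=
    iSup₂_le fun j hj y hy => horth i j hj.symm x hx y hy
  exact hB.eq_zero_of_nonpos (le_of_eq (this hx'))

/-- The span of a linearly independent diagram is isometric to the rescaled root lattice. -/
lemma IsDiagram.exists_isometryEquiv {s : Set L} {X : SimplyLacedType} {p : ℕ}
    {e : Fin X.rank → L} (h : IsDiagram B s X p e) (hli : LinearIndependent ℤ e) :
    ∃ φ : LinearMap.BilinForm.IsometryEquiv (SimplyLacedType.rescaledForm p X)
        (B.restrict (Submodule.span ℤ (Set.range e))),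
      ∀ j, (φ (X.simpleRoot j) : L) = e j := by
  let ψ := (Module.Basis.span hli).equivFun.symm
  have hψ : ∀ x, (ψ x : L) = ∑ i, x i • e i := fun x => by
    simp [ψ, Module.Basis.equivFun_symm_apply, Module.Basis.span_apply]
  refine ⟨⟨ψ, fun x y => ?_⟩, fun j => ?_⟩
  · change B (ψ x : L) (ψ y : L) = (p : ℤ) * Matrix.toBilin' X.cartanMatrix x y
    rw [hψ, hψ, bilin_sum_smul h.gram, Matrix.toBilin'_apply]
    congr 1
    exact Finset.sum_congr rfl fun i _ => Finset.sum_congr rfl fun j _ => by ring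
  · refine (hψ _).trans ?_
    simp [SimplyLacedType.simpleRoot, Pi.single_apply]

end Assembly

end ScreeningLattice

theorem theorem5p11 {L : Type*} [AddCommGroup L] [Module.Free ℤ L] [Module.Finite ℤ L]
    (B : LinearMap.BilinForm ℤ L) (hB : IsPosDefEven B)
    (S : Set L) (hS : IsScreeningSystem B S) (hgen : Submodule.span ℤ S = ⊤) :
    ∃ (m : ℕ) (K : Fin m → SimplyLacedType) (p : Fin m → ℕ) (N : Fin m → Submodule ℤ L)
      (b : Module.Basis (Σ i : Fin m, Fin (K i).rank) ℤ L),
      (∀ x, b x ∈ screeners B) ∧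
      (∀ i, 0 < p i) ∧
      IsOrthogonalDirectSum B N ∧
      (∀ i, Submodule.span ℤ (Set.range fun j => b ⟨i, j⟩) = N i) ∧
      ∀ i, ∃ e : LinearMap.BilinForm.IsometryEquiv (SimplyLacedType.rescaledForm (p i) (K i))
          (B.restrict (N i)),
        ∀ j, (e ((K i).simpleRoot j) : L) = b ⟨i, j⟩ := by
  obtain ⟨f, Δ, hΔ, hshort, hspan⟩ := exists_isSimplyLacedSystem hB
  have htop : Submodule.span ℤ Δ = ⊤ := by
    rw [hspan, eq_top_iff, ← hgen, Submodule.span_le]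
    exact hS.1.trans (screeners_subset_span_shortScreeners hB)
  obtain ⟨m, K, p, e, hdiag, horth, hcover⟩ :=
    exists_diagram_decomposition hB ((finite_shortScreeners hB).subset hshort) hΔ
  let v : (Σ i : Fin m, Fin (K i).rank) → L := fun x => e x.1 x.2
  have hv : ∀ x, v x ∈ Δ := fun x => (hdiag x.1).mem x.2
  have hinj : Function.Injective v := by
    rintro ⟨i, k⟩ ⟨j, l⟩ hij
    change e i k = e j l at hij
    -- A vector common to two components would be orthogonal to itself.
    obtain rfl : i = j := by
      by_contra hne
      have h0 := horth i j hne k l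
      rw [← hij] at h0
      exact (hB.pos _ (ne_zero_of_mem_shortScreeners (hshort (hv ⟨i, k⟩)))).ne' h0
    rw [(hdiag i).injective hij]
  have hli : LinearIndependent ℤ v :=
    (hΔ.linearIndependent hB).comp (fun x => ⟨v x, hv x⟩) fun x y hxy =>
      hinj (congrArg Subtype.val hxy)
  have hsup : ⊤ ≤ Submodule.span ℤ (Set.range v) := by
    rw [← htop]
    refine Submodule.span_mono fun x hx => ?_
    obtain ⟨i, k, rfl⟩ := hcover x hx
    exact ⟨⟨i, k⟩, rfl⟩
  have hb : ∀ x, Module.Basis.mk hli hsup x = v x := fun x => Module.Basis.mk_apply hli hsup x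
  refine ⟨m, K, p, fun i => Submodule.span ℤ (Set.range (e i)), Module.Basis.mk hli hsup,
    fun x => ?_, fun i => (hdiag i).scale_pos, isOrthogonalDirectSum_of_orthogonal hB ?_ ?_,
    fun i => ?_, fun i => ?_⟩
  · rw [hb]
    exact (hshort (hv x)).1
  · intro i j hij x hx y hy
    refine bilin_eq_zero_of_mem_span ?_ hx hy
    rintro _ ⟨k, rfl⟩ _ ⟨l, rfl⟩
    exact horth i j hij k l
  · rw [eq_top_iff]
    refine hsup.trans (Submodule.span_le.2 ?_)
    rintro _ ⟨x, rfl⟩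
    exact Submodule.mem_iSup_of_mem x.1 (Submodule.subset_span ⟨x.2, rfl⟩)
  · simp only [hb]
    rfl
  · simp only [hb]
    exact (hdiag i).exists_isometryEquiv (hli.comp _ sigma_mk_injective)
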